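/- Let $(a_n)_{n\in\mathbb Z}$, $(p_n)_{n\in\mathbb Z}$, $(q_n)_{n\in\mathbb Z}$ be complex sequences with $a_n\neq 0$ for all $n$, and suppose that for some $\varepsilon>0$ $$\sup_{n\in\mathbb Z}\, e^{\varepsilon|n|}\bigl(|1-a_n|+|p_n|+|q_n|\bigr)<\infty .$$ For $\lambda\in\mathbb C$ let $L_\lambda$ be the operator generated in $\ell^2(\mathbb Z)$ by $$L_\lambda y_n=\Delta(a_{n-1}\Delta y_{n-1})+(q_n+2\lambda p_n+\lambda^2)y_n,\qquad \Delta y_n=y_{n+1}-y_n .$$ Definitions. An eigenvalue is a $\lambda\in\mathbb C$ for which $L_\lambda y=0$ has a nonzero solution $y\in\ell^2(\mathbb Z)$. Put $\lambda=2\cos(z/2)$ and $$P^+=\{\eta+i\varphi:\eta\in[-\pi,3\pi],\ \varphi>0\},\qquad P_0=(-\pi,3\pi)\setminus\{0,\pi,2\pi\}.$$ A spectral singularity is a point $\lambda_0=2\cos(z_0/2)$ with $z_0\in P_0$ such that some entry $(L_\lambda^{-1}e_m)_n$ of the kernel of the resolvent, where $(e_m)_{m\in\mathbb Z}$ is the standard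 basis of $\ell^2(\mathbb Z)$, as a function of $z$ with $\operatorname{Im}z>0$ near $z_0$, has a pole at $z_0$ (that is, the bounded inverse $L_\lambda^{-1}$ exists for all $z$ with $\operatorname{Im}z>0$ close enough to $z_0$, and there the entry agrees with a function meromorphic at $z_0$ that has a pole at $z_0$). For $\operatorname{Im}z\ge 0$ let $f^{\pm}(z)$ be the Jost solutions, i.e. the solutions of $L_\lambda y=0$, $\lambda=2\cos(z/2)$, with $$f^{\pm}_n(z)=(-1)^n e^{\pm inz}(1+o(1))\quad\text{as } n\to\pm\infty,$$ and let $\Phi(z)=a_n\bigl(f^-_n(z)f^+_{n+1}(z)-f^-_{n+1}(z)f^+_n(z)\bigr)$, which does not depend on $n$. The multiplicity of an eigenvalue or spectral singularity $\lambda$ is the multiplicity of the corresponding zero (or zeros) $z\in P^+\cup P_0$, $2\cos(z/2)=\lambda$, of $\Phi$; at a point of $P_0$ it is understood as the order of vanishing of the analytic continuation of $\Phi$ to a neighbourhood of that point. Theorem. The set of eigenvalues and the set of spectral singularities of $L_\lambda$ are both finite, and each eigenvalue and each spectral singularity is of finite multiplicity: it corresponds to at least one zero of $\Phi$ in $P^+\cup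 P_0$, and every zero of $\Phi$ in $P^+\cup P_0$ corresponding to it has finite multiplicity. -/

import Mathlib

open Filter Topology

/-- The Hilbert space `ℓ²(ℤ)` of square summable complex sequences indexed by `ℤ`. -/
abbrev EllTwo : Type := lp (fun _ : ℤ => ℂ) 2

/-- The difference expression
`L_λ y_n = Δ(a_{n-1} Δ y_{n-1}) + (q_n + 2 λ p_n + λ²) y_n`, where `Δ y_n = y_{n+1} - y_n`. -/
noncomputable def pencil (a p q : ℤ → ℂ) (lam : ℂ) (y : ℤ → ℂ) (n : ℤ) : ℂ :=
  fwdDiff (1 : ℤ) (fun k : ℤ => a (k - 1) * fwdDiff (1 : ℤ) y (k - 1)) n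
    + (q n + 2 * lam * p n + lam ^ 2) * y n

/-- The eigenvalues of the pencil: those `λ` for which `L_λ y = 0` has a nonzero solution `y` in
`ℓ²(ℤ)`. -/
def pencilEigenvalues (a p q : ℤ → ℂ) : Set ℂ :=
  {lam | ∃ y : EllTwo, y ≠ 0 ∧ ∀ n : ℤ, pencil a p q lam y n = 0}

/-- `R` is the bounded inverse `L_λ⁻¹` on `ℓ²(ℤ)` (the resolvent operator of the pencil at `λ`). -/
def IsPencilResolvent (a p q : ℤ → ℂ) (lam : ℂ) (R : EllTwo →L[ℂ] EllTwo) : Prop :=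
  (∀ (φ : EllTwo) (n : ℤ), pencil a p q lam (R φ) n = φ n) ∧
    ∀ y φ : EllTwo, (∀ n : ℤ, pencil a p q lam y n = φ n) → R φ = y

/-- The half strip `P⁺ = {η + iφ : η ∈ [-π, 3π], φ > 0}`. -/
def halfStrip : Set ℂ :=
  {z | z.re ∈ Set.Icc (-Real.pi) (3 * Real.pi) ∧ 0 < z.im}

/-- The real set `P₀ = (-π, 3π) \ {0, π, 2π}`. -/
def boundarySet : Set ℂ :=
  {z | z.im = 0 ∧ z.re ∈ Set.Ioo (-Real.pi) (3 * Real.pi) \ {0, Real.pi, 2 * Real.pi}}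

/-- Some entry `(n, m)` of the kernel `(L_λ⁻¹ e_m)_n`, `λ = 2 cos (z / 2)`, of the resolvent, as a
function of `z` in the upper half plane near the real point `z₀`, has a pole at `z₀`. -/
def ResolventKernelHasPole (a p q : ℤ → ℂ) (z₀ : ℂ) : Prop :=
  ∃ (n m : ℤ) (G : ℂ → ℂ), MeromorphicAt G z₀ ∧ meromorphicOrderAt G z₀ < 0 ∧
    ∀ᶠ z in 𝓝[{w : ℂ | 0 < w.im}] z₀, ∃ R : EllTwo →L[ℂ] EllTwo,
      IsPencilResolvent a p q (2 * Complex.cos (z / 2)) R ∧ R (lp.single 2 m (1 : ℂ)) n = G z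

/-- The spectral singularities of the pencil: the points `λ = 2 cos (z / 2)`, `z ∈ P₀`, of the
continuous spectrum at which the kernel of the resolvent has a pole. -/
def pencilSpectralSingularities (a p q : ℤ → ℂ) : Set ℂ :=
  {lam | ∃ z ∈ boundarySet, lam = 2 * Complex.cos (z / 2) ∧ ResolventKernelHasPole a p q z}

/-- `y` solves `L_λ y = 0`, `λ = 2 cos (z / 2)`, and `y_n = (-1)^n e^{inz} (1 + o(1))` as
`n → ∞`. -/
def IsJostRight (a p q : ℤ → ℂ) (z : ℂ) (y : ℤ → ℂ) : Prop :=
  (∀ n : ℤ, pencil a p q (2 * Complex.cos (z / 2)) y n = 0) ∧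
    Tendsto (fun n : ℤ => (-1 : ℂ) ^ n * Complex.exp (-(Complex.I * n * z)) * y n) atTop (𝓝 1)

/-- `y` solves `L_λ y = 0`, `λ = 2 cos (z / 2)`, and `y_n = (-1)^n e^{-inz} (1 + o(1))` as
`n → -∞`. -/
def IsJostLeft (a p q : ℤ → ℂ) (z : ℂ) (y : ℤ → ℂ) : Prop :=
  (∀ n : ℤ, pencil a p q (2 * Complex.cos (z / 2)) y n = 0) ∧
    Tendsto (fun n : ℤ => (-1 : ℂ) ^ n * Complex.exp (Complex.I * n * z) * y n) atBot (𝓝 1)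

/-- The Jost solution `f⁺(z)`, for `Im z ≥ 0`. -/
noncomputable def jostRight (a p q : ℤ → ℂ) (z : ℂ) : ℤ → ℂ :=
  Classical.epsilon (IsJostRight a p q z)

/-- The Jost solution `f⁻(z)`, for `Im z ≥ 0`. -/
noncomputable def jostLeft (a p q : ℤ → ℂ) (z : ℂ) : ℤ → ℂ :=
  Classical.epsilon (IsJostLeft a p q z)

/-- The Wronskian `a_n (u_n v_{n+1} - u_{n+1} v_n)`, which does not depend on `n` when `u` and `v`
solve the same equation `L_λ y = 0`. -/
def pencilWronskian (a u v : ℤ → ℂ) (n : ℤ) : ℂ :=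
  a n * (u n * v (n + 1) - u (n + 1) * v n)

/-- The function `Φ(z) = W[f⁻(z), f⁺(z)]`, for `Im z ≥ 0`. -/
noncomputable def jostPhi (a p q : ℤ → ℂ) (z : ℂ) : ℂ :=
  pencilWronskian a (jostLeft a p q z) (jostRight a p q z) 0

/-- `Φ`, a function on the closed upper half plane, vanishes to the order exactly `m` at `z₀`:
near `z₀` it is the restriction of a function analytic at `z₀` with that order of vanishing. -/
def HasZeroOrder (Φ : ℂ → ℂ) (z₀ : ℂ) (m : ℕ) : Prop :=
  ∃ F : ℂ → ℂ, AnalyticAt ℂ F z₀ ∧ (∀ᶠ z in 𝓝[{w : ℂ | 0 ≤ w.im}] z₀, F z = Φ z) ∧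
    analyticOrderAt F z₀ = (m : ℕ∞)

/-- `λ` has finite multiplicity: it corresponds, under `λ = 2 cos (z / 2)`, to a zero of `Φ` in
`P⁺ ∪ P₀`, and every zero of `Φ` in `P⁺ ∪ P₀` that corresponds to it has a finite positive
multiplicity. -/
def HasFiniteMultiplicity (a p q : ℤ → ℂ) (lam : ℂ) : Prop :=
  (∃ z ∈ halfStrip ∪ boundarySet, lam = 2 * Complex.cos (z / 2) ∧ jostPhi a p q z = 0) ∧
    ∀ z ∈ halfStrip ∪ boundarySet, lam = 2 * Complex.cos (z / 2) → jostPhi a p q z = 0 →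
      ∃ m : ℕ, 0 < m ∧ HasZeroOrder (jostPhi a p q) z m

/-! Put `w = e^{iz/2}`, so that `λ = w + w⁻¹` and `Im z ≥ 0` becomes `0 < |w| ≤ 1`. The right Jost
solution is `x^n u_n(w)` with `x = -w²`. Exponential decay of the coefficients makes the backward
recursion for `u_n` solvable from infinity not only for `|w| ≤ 1` but on a disc of radius `R > 1`,
holomorphically in `w` (`exists_normalized_jost`). Reflection `n ↦ -n` gives the left solution.

Hence `Φ(z) = -Ψ(w) / w²` with `Ψ` holomorphic on a disc `|w| < R`, `R > 1`, and `Ψ 0 ≠ 0`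
(`IsAdmissible.exists_continuation`). The closed unit disc is compact in the larger one, so `Ψ` has
finitely many zeros there, each of finite order. The origin, which stands for `Im z = ∞`, cannot be
an accumulation point, and neither can the unit circle, which stands for real `z`.

It remains to see that eigenvalues and spectral singularities come from zeros of `Φ`. A solution in
`ℓ²` is a multiple of both Jost solutions, so their Wronskian vanishes. The resolvent kernel times
`Φ` is a product of Jost solutions, continuous up to the real axis, so a pole at a real point forces
`Φ` to vanish there. -/

/-! ### Backward recursions -/

/-- A backward recursion `S n = T n (S (n + 1))` whose maps are `θ`-Lipschitz and almost fix `e`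
has a solution converging to `e` that depends holomorphically on the parameter. -/
theorem exists_backward_orbit {E : Type*} [NormedAddCommGroup E] [NormedSpace ℂ E]
    [CompleteSpace E] {U : Set ℂ} (hU : IsOpen U) (T : ℕ → ℂ → E → E) (e : E) {θ μ C : ℝ}
    (hθ : 0 ≤ θ) (hμ : 0 ≤ μ) (hθμ : θ * μ < 1)
    (hlip : ∀ n, ∀ w ∈ U, ∀ v v', ‖T n w v - T n w v'‖ ≤ θ * ‖v - v'‖)
    (he : ∀ n, ∀ w ∈ U, ‖T n w e - e‖ ≤ C * μ ^ n)
    (hdiff : ∀ n (f : ℂ → E), DifferentiableOn ℂ f U →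
      DifferentiableOn ℂ (fun w => T n w (f w)) U) :
    ∃ S : ℕ → ℂ → E, (∀ n, DifferentiableOn ℂ (S n) U) ∧
      (∀ n, ∀ w ∈ U, S n w = T n w (S (n + 1) w)) ∧
      ∀ n, ∀ w ∈ U, ‖S n w - e‖ ≤ C * μ ^ n / (1 - θ * μ) := by
  -- `P N n` is `T n ∘ ⋯ ∘ T (n + N - 1)` applied to `e`. Passing from `N` to `N + 1` perturbs the
  -- innermost argument by at most `C μ^(n+N)`, and the `N` outer maps magnify this by at most
  -- `θ^N`. So `θ > 1` is allowed as long as `θ μ < 1`.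
  let P : ℕ → ℕ → ℂ → E := fun N =>
    Nat.rec (fun _ _ => e) (fun _ F n w => T n w (F (n + 1) w)) N
  have hP0 : ∀ n w, P 0 n w = e := fun _ _ => rfl
  have hPs : ∀ N n w, P (N + 1) n w = T n w (P N (n + 1) w) := fun _ _ _ => rfl
  have hPd : ∀ N n, DifferentiableOn ℂ (P N n) U := by
    intro N
    induction N with
    | zero => intro n; exact differentiableOn_const e
    | succ N ih => intro n; exact hdiff n _ (ih (n + 1))
  have hstep : ∀ N n, ∀ w ∈ U, ‖P (N + 1) n w - P N n w‖ ≤ C * μ ^ n * (θ * μ) ^ N := by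
    intro N
    induction N with
    | zero =>
      intro n w hw
      simpa [hPs, hP0] using he n w hw
    | succ N ih =>
      intro n w hw
      rw [hPs (N + 1), hPs N]
      refine (hlip n w hw _ _).trans ?_
      calc θ * ‖P (N + 1) (n + 1) w - P N (n + 1) w‖
          ≤ θ * (C * μ ^ (n + 1) * (θ * μ) ^ N) := by gcongr; exact ih (n + 1) w hw
        _ = C * μ ^ n * (θ * μ) ^ (N + 1) := by ring
  have hgeo : ∀ n, HasSum (fun N : ℕ => C * μ ^ n * (θ * μ) ^ N) (C * μ ^ n / (1 - θ * μ)) := by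
    intro n
    simpa [div_eq_mul_inv] using
      (hasSum_geometric_of_lt_one (mul_nonneg hθ hμ) hθμ).mul_left (C * μ ^ n)
  have hsum : ∀ n, ∀ w ∈ U, Summable fun N => P (N + 1) n w - P N n w := fun n w hw =>
    Summable.of_norm_bounded (hgeo n).summable fun N => hstep N n w hw
  let S : ℕ → ℂ → E := fun n w => e + ∑' N, (P (N + 1) n w - P N n w)
  have hlim : ∀ n, ∀ w ∈ U, Tendsto (fun N => P N n w) atTop (𝓝 (S n w)) := by
    intro n w hw
    have h := (hsum n w hw).hasSum.tendsto_sum_nat.const_add e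
    refine h.congr fun N => ?_
    rw [Finset.sum_range_sub (fun N => P N n w), hP0]
    abel
  refine ⟨S, fun n => ?_, fun n w hw => ?_, fun n w hw => ?_⟩
  · refine (differentiableOn_const e).add ?_
    exact Complex.differentiableOn_tsum_of_summable_norm (hgeo n).summable
      (fun N => (hPd (N + 1) n).sub (hPd N n)) hU fun N w hw => hstep N n w hw
  · have h1 := (hlim n w hw).comp (tendsto_add_atTop_nat 1)
    have hcont : Continuous (T n w) :=
      (LipschitzWith.of_dist_le_mul (K := θ.toNNReal) fun v v' => by
        rw [dist_eq_norm, dist_eq_norm, Real.coe_toNNReal _ hθ]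
        exact hlip n w hw v v').continuous
    have h2 := (hcont.tendsto _).comp (hlim (n + 1) w hw)
    exact tendsto_nhds_unique h1 h2
  · have : S n w - e = ∑' N, (P (N + 1) n w - P N n w) := by simp [S]
    rw [this]
    exact tsum_of_norm_bounded (hgeo n) fun N => hstep N n w hw

/-- A sequence can be continued backwards from `n₀` by any second order recursion. -/
theorem exists_backward_extension {V : Type*} (h : ℤ → V → V → V) (s : ℤ → V) (n₀ : ℤ) :
    ∃ u : ℤ → V, (∀ n, n₀ ≤ n → u n = s n) ∧
      ∀ n, n ≤ n₀ → u (n - 1) = h n (u n) (u (n + 1)) := by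
  -- The state is the pair `(u (n₀ - k), u (n₀ - k + 1))`, which turns the second order recursion
  -- into a first order one.
  let g : ℕ → V × V := fun k =>
    Nat.rec (s n₀, s (n₀ + 1)) (fun k v => (h (n₀ - k) v.1 v.2, v.1)) k
  have hg : ∀ k : ℕ, g (k + 1) = (h (n₀ - k) (g k).1 (g k).2, (g k).1) := fun _ => rfl
  let u : ℤ → V := fun n => if n₀ ≤ n then s n else (g (n₀ - n).toNat).1
  have hu1 : ∀ n, n₀ ≤ n → u n = s n := fun n hn => if_pos hn
  have hu2 : ∀ k : ℕ, u (n₀ - (k + 1)) = (g (k + 1)).1 := by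
    intro k
    have : (n₀ - (n₀ - ((k : ℤ) + 1))).toNat = k + 1 := by omega
    simp only [u]
    rw [if_neg (by omega), this]
  have hgu : ∀ k : ℕ, g k = (u (n₀ - k), u (n₀ - k + 1)) := by
    intro k
    induction k with
    | zero =>
      have e1 : u n₀ = s n₀ := hu1 _ le_rfl
      have e2 : u (n₀ + 1) = s (n₀ + 1) := hu1 _ (by omega)
      change (s n₀, s (n₀ + 1)) = _
      rw [Nat.cast_zero, sub_zero, e1, e2]
    | succ k ih =>
      refine Prod.ext ?_ ?_
      · push_cast; exact (hu2 k).symm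
      · rw [hg, ih]; push_cast; congr 1; ring
  refine ⟨u, hu1, fun n hn => ?_⟩
  obtain ⟨k, rfl⟩ : ∃ k : ℕ, n = n₀ - k := ⟨(n₀ - n).toNat, by omega⟩
  have := hu2 k
  rw [hg, hgu k] at this
  rw [show n₀ - (k : ℤ) - 1 = n₀ - (k + 1) by ring, this]

/-! ### The normalized Jost solution on a disc of radius greater than one -/

/-- The perturbation term of the recursion satisfied by `u_n = x^{-n} y_n`, where `L_λ y = 0`,
`x = -w²` and `λ = w + w⁻¹`. -/
noncomputable def jostDefect (a p q : ℤ → ℂ) (n : ℤ) (w : ℂ) : ℂ :=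
  -(w ^ 2) * (2 - a n - a (n - 1) + q n) - 2 * (w ^ 3 + w) * p n

theorem differentiable_jostDefect (a p q : ℤ → ℂ) (n : ℤ) :
    Differentiable ℂ (jostDefect a p q n) := by
  unfold jostDefect
  fun_prop

/-- `u` solves the recursion for the normalized Jost solution at the parameter `w`. -/
def IsNormalizedSolution (a p q : ℤ → ℂ) (w : ℂ) (u : ℤ → ℂ) (n : ℤ) : Prop :=
  a (n - 1) * u (n - 1) = (1 + w ^ 4 - jostDefect a p q n w) * u n - w ^ 4 * a n * u (n + 1)

/-- This is the coefficient that drives the first order system below; it vanishes for the free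
equation. The index `k + 1` is paired with `μ ^ k` because the defect at `k + 1` involves `a k`. -/
theorem norm_sub_jostDefect_le {a p q : ℤ → ℂ} {μ C R : ℝ} (hμ : 0 < μ) (hμ1 : μ < 1)
    (hC : 0 ≤ C) (hR : 0 ≤ R)
    (ha : ∀ n : ℕ, ‖1 - a n‖ ≤ C * μ ^ n) (hp : ∀ n : ℕ, ‖p n‖ ≤ C * μ ^ n)
    (hq : ∀ n : ℕ, ‖q n‖ ≤ C * μ ^ n) (k : ℕ) {w : ℂ} (hw : ‖w‖ ≤ R) :
    ‖w ^ 4 * (1 - a (k + 1) ^ 2) - jostDefect a p q (k + 1) w‖ ≤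
      (R ^ 4 * (C * (2 + C)) + R ^ 2 * (3 * C) + 2 * (R ^ 3 + R) * C) * μ ^ k := by
  have hk : 0 ≤ μ ^ k := by positivity
  have hk1 : μ ^ k ≤ 1 := pow_le_one₀ hμ.le hμ1.le
  have hle : μ ^ (k + 1) ≤ μ ^ k := pow_le_pow_of_le_one hμ.le hμ1.le (Nat.le_succ k)
  have hCle : C * μ ^ (k + 1) ≤ C * μ ^ k := by gcongr
  have ha0 : ‖1 - a k‖ ≤ C * μ ^ k := ha k
  have ha1 : ‖1 - a (k + 1)‖ ≤ C * μ ^ k := le_trans (by exact_mod_cast ha (k + 1)) hCle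
  have hp1 : ‖p (k + 1)‖ ≤ C * μ ^ k := le_trans (by exact_mod_cast hp (k + 1)) hCle
  have hq1 : ‖q (k + 1)‖ ≤ C * μ ^ k := le_trans (by exact_mod_cast hq (k + 1)) hCle
  have e : w ^ 4 * (1 - a (k + 1) ^ 2) - jostDefect a p q (k + 1) w =
      w ^ 4 * ((1 - a (k + 1)) * (2 - (1 - a (k + 1)))) +
        w ^ 2 * ((1 - a (k + 1)) + (1 - a k) + q (k + 1)) + 2 * (w ^ 3 + w) * p (k + 1) := by
    unfold jostDefect
    rw [add_sub_cancel_right]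
    ring
  rw [e]
  have h1 : ‖w ^ 4 * ((1 - a (k + 1)) * (2 - (1 - a (k + 1))))‖ ≤
      R ^ 4 * ((C * μ ^ k) * (2 + C)) := by
    rw [norm_mul, norm_mul, norm_pow]
    gcongr
    refine (norm_sub_le _ _).trans ?_
    have : C * μ ^ k ≤ C := mul_le_of_le_one_right hC hk1
    have h2 : ‖(2 : ℂ)‖ = 2 := by simp
    linarith
  have h2 : ‖w ^ 2 * ((1 - a (k + 1)) + (1 - a k) + q (k + 1))‖ ≤
      R ^ 2 * (C * μ ^ k + C * μ ^ k + C * μ ^ k) := by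
    rw [norm_mul, norm_pow]
    gcongr
    exact norm_add₃_le.trans (by gcongr)
  have h3 : ‖2 * (w ^ 3 + w) * p (k + 1)‖ ≤ 2 * (R ^ 3 + R) * (C * μ ^ k) := by
    rw [norm_mul, norm_mul]
    gcongr
    · simp
    · refine (norm_add_le _ _).trans ?_
      rw [norm_pow]
      gcongr
  calc _ ≤ _ := norm_add₃_le
    _ ≤ _ := add_le_add (add_le_add h1 h2) h3
    _ = _ := by ring

/-- In the free case `u_{n-1} - u_n = w⁴ (u_n - u_{n+1})`: going backwards, differences are
multiplied by `w⁴`. For `|w|` slightly above one this growth is beaten by the decay `μ^n` of the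
perturbation, so `exists_backward_orbit` applies to the pair formed by `u` and its rescaled
difference. -/
theorem exists_normalized_solution_near_infinity {a p q : ℤ → ℂ} (ha0 : ∀ n, a n ≠ 0) {μ C : ℝ}
    (hμ : 0 < μ) (hμ1 : μ < 1)
    (ha : ∀ n : ℕ, ‖1 - a n‖ ≤ C * μ ^ n) (hp : ∀ n : ℕ, ‖p n‖ ≤ C * μ ^ n)
    (hq : ∀ n : ℕ, ‖q n‖ ≤ C * μ ^ n) :
    ∃ R : ℝ, 1 < R ∧ ∃ (n₀ : ℕ) (s : ℤ → ℂ → ℂ),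
      (∀ n, DifferentiableOn ℂ (s n) (Metric.ball 0 R)) ∧
      (∀ n : ℤ, n₀ + 1 ≤ n → ∀ w ∈ Metric.ball (0 : ℂ) R,
        IsNormalizedSolution a p q w (fun k => s k w) n) ∧
      ∀ w ∈ Metric.ball (0 : ℂ) R, Tendsto (fun n : ℤ => s n w) atTop (𝓝 1) := by
  have hC : 0 ≤ C := by simpa using (norm_nonneg _).trans (ha 0)
  -- `θ` is the Lipschitz constant of the system: above 1 to leave room for `R ^ 4 < θ` with `R >
  -- 1`, below `μ⁻¹` to keep `θ μ < 1`.
  obtain ⟨θ, hθ1, hθμ⟩ : ∃ θ : ℝ, 1 < θ ∧ θ < μ⁻¹ := exists_between ((one_lt_inv₀ hμ).2 hμ1)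
  have hθ0 : 0 < θ := by linarith
  have hθμ' : θ * μ < 1 := by rwa [← lt_div_iff₀ hμ, one_div]
  obtain ⟨R, hR1, hRθ⟩ : ∃ R : ℝ, 1 < R ∧ R ^ 4 < θ := by
    obtain ⟨R, h1, h2⟩ : ∃ R : ℝ, 1 < R ∧ R < √√θ :=
      exists_between (by rw [Real.lt_sqrt (by norm_num), Real.lt_sqrt (by norm_num)]; simpa)
    refine ⟨R, h1, ?_⟩
    calc R ^ 4 < (√√θ) ^ 4 := by gcongr
      _ = ((√√θ) ^ 2) ^ 2 := by ring
      _ = θ := by rw [Real.sq_sqrt (Real.sqrt_nonneg _), Real.sq_sqrt hθ0.le]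
  have hR0 : 0 ≤ R := by linarith
  set K : ℝ := R ^ 4 * (C * (2 + C)) + R ^ 2 * (3 * C) + 2 * (R ^ 3 + R) * C with hK
  have hK0 : 0 ≤ K := by positivity
  have hKb := fun (k : ℕ) (w : ℂ) (hw : ‖w‖ ≤ R) =>
    norm_sub_jostDefect_le hμ hμ1 hC hR0 ha hp hq k hw
  rw [← hK] at hKb
  -- `κ` rescales the difference component. A small `κ` keeps its contribution to the first
  -- component within `θ`; the factor `κ⁻¹` appearing in the second one multiplies `μ ^ k` and is
  -- absorbed by taking `n₀` large.
  obtain ⟨κ, hκ0, hκθ⟩ : ∃ κ : ℝ, 0 < κ ∧ 1 + κ * θ < θ := by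
    refine ⟨(θ - 1) / (2 * θ), by apply div_pos <;> linarith, ?_⟩
    have : (θ - 1) / (2 * θ) * θ = (θ - 1) / 2 := by field_simp
    linarith
  have hpow : Tendsto (fun n : ℕ => μ ^ n) atTop (𝓝 0) :=
    tendsto_pow_atTop_nhds_zero_of_lt_one hμ.le hμ1
  have hat : Tendsto (fun n : ℕ => a n) atTop (𝓝 1) := by
    have h1 : Tendsto (fun n : ℕ => 1 - a n) atTop (𝓝 0) :=
      squeeze_zero_norm ha (by simpa using hpow.const_mul C)
    simpa using h1.const_sub 1
  have hev1 : ∀ᶠ k : ℕ in atTop, R ^ 4 * ‖a ((k + 1 : ℕ) : ℤ)‖ + κ⁻¹ * (K * μ ^ k) < θ := by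
    have h1 := ((hat.comp (tendsto_add_atTop_nat 1)).norm.const_mul (R ^ 4)).add
      ((hpow.const_mul K).const_mul κ⁻¹)
    exact h1.eventually_lt_const (by simpa using hRθ)
  have hev2 : ∀ᶠ k : ℕ in atTop, (1 + κ * θ) * ‖(a k)⁻¹‖ < θ := by
    have h1 := ((hat.inv₀ one_ne_zero).norm.const_mul (1 + κ * θ))
    exact h1.eventually_lt_const (by simpa using hκθ)
  obtain ⟨n₀, hn₀⟩ := eventually_atTop.1 (hev1.and hev2)
  let c : ℕ → ℂ → ℂ := fun k w =>
    w ^ 4 * (1 - a ((k : ℤ) + 1) ^ 2) - jostDefect a p q ((k : ℤ) + 1) w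
  have hcd : ∀ k, Differentiable ℂ (c k) := fun k => by
    have := differentiable_jostDefect a p q ((k : ℤ) + 1)
    simp only [c]
    fun_prop
  -- The state is `(u_k, d_k)` with `κ d_k = a_k u_k - u_{k+1}`, and `G k` computes `d_k` from the
  -- state at `k + 1`. Weighting the difference by `a_k` makes the second order equation split
  -- exactly, with `c k` as only coupling from `u` to `d`.
  let G : ℕ → ℂ → ℂ × ℂ → ℂ := fun k w v =>
    w ^ 4 * a ((k : ℤ) + 1) * v.2 + (κ : ℂ)⁻¹ * (c k w * v.1)
  let T : ℕ → ℂ → ℂ × ℂ → ℂ × ℂ := fun k w v =>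
    ((a ((n₀ + k : ℕ) : ℤ))⁻¹ * (v.1 + κ * G (n₀ + k) w v), G (n₀ + k) w v)
  have hnκ : ‖(κ : ℂ)‖ = κ := by simp [abs_of_pos hκ0]
  have hGsub : ∀ k w v v', G k w v - G k w v' = G k w (v - v') := by
    intro k w v v'
    simp only [G, Prod.fst_sub, Prod.snd_sub]
    ring
  have hGb : ∀ k, n₀ ≤ k → ∀ w ∈ Metric.ball (0 : ℂ) R, ∀ v, ‖G k w v‖ ≤ θ * ‖v‖ := by
    intro k hk w hw v
    have hw' : ‖w‖ ≤ R := by simpa using (Metric.mem_ball.1 hw).le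
    have h1 := (hn₀ k hk).1
    push_cast at h1
    calc ‖G k w v‖ ≤ ‖w ^ 4 * a ((k : ℤ) + 1) * v.2‖ + ‖(κ : ℂ)⁻¹ * (c k w * v.1)‖ :=
          norm_add_le _ _
      _ = ‖w‖ ^ 4 * ‖a ((k : ℤ) + 1)‖ * ‖v.2‖ + κ⁻¹ * (‖c k w‖ * ‖v.1‖) := by
          rw [norm_mul, norm_mul, norm_pow, norm_mul, norm_mul, norm_inv, hnκ]
      _ ≤ R ^ 4 * ‖a ((k : ℤ) + 1)‖ * ‖v‖ + κ⁻¹ * (K * μ ^ k * ‖v‖) := by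
          gcongr
          · exact norm_snd_le v
          · exact hKb k w hw'
          · exact norm_fst_le v
      _ = (R ^ 4 * ‖a ((k : ℤ) + 1)‖ + κ⁻¹ * (K * μ ^ k)) * ‖v‖ := by ring
      _ ≤ θ * ‖v‖ := by gcongr
  have hlip : ∀ k, ∀ w ∈ Metric.ball (0 : ℂ) R, ∀ v v', ‖T k w v - T k w v'‖ ≤ θ * ‖v - v'‖ := by
    intro k w hw v v'
    have hG := hGb (n₀ + k) (by omega) w hw (v - v')
    have h2 := (hn₀ (n₀ + k) (by omega)).2
    have e : T k w v - T k w v' = ((a ((n₀ + k : ℕ) : ℤ))⁻¹ *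
        ((v - v').1 + κ * G (n₀ + k) w (v - v')), G (n₀ + k) w (v - v')) := by
      rw [← hGsub]
      refine Prod.ext ?_ rfl
      simp only [T, Prod.fst_sub]
      ring
    rw [e]
    refine max_le ?_ hG
    simp only
    calc ‖(a ((n₀ + k : ℕ) : ℤ))⁻¹ * ((v - v').1 + κ * G (n₀ + k) w (v - v'))‖
        ≤ ‖(a ((n₀ + k : ℕ) : ℤ))⁻¹‖ * (‖v - v'‖ + κ * (θ * ‖v - v'‖)) := by
          rw [norm_mul]
          gcongr
          refine (norm_add_le _ _).trans ?_
          rw [norm_mul, hnκ]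
          gcongr
          exact norm_fst_le _
      _ = ((1 + κ * θ) * ‖(a ((n₀ + k : ℕ) : ℤ))⁻¹‖) * ‖v - v'‖ := by ring
      _ ≤ θ * ‖v - v'‖ := by gcongr
  have he : ∀ k, ∀ w ∈ Metric.ball (0 : ℂ) R,
      ‖T k w (1, 0) - (1, 0)‖ ≤ (κ⁻¹ * K + θ * (C + K)) * μ ^ k := by
    intro k w hw
    have hw' : ‖w‖ ≤ R := by simpa using (Metric.mem_ball.1 hw).le
    have h2 := (hn₀ (n₀ + k) (by omega)).2
    have hinv : ‖(a ((n₀ + k : ℕ) : ℤ))⁻¹‖ ≤ θ := by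
      refine le_trans ?_ h2.le
      exact le_mul_of_one_le_left (norm_nonneg _) (by nlinarith [mul_pos hκ0 hθ0])
    have hle : μ ^ (n₀ + k) ≤ μ ^ k := pow_le_pow_of_le_one hμ.le hμ1.le (by omega)
    have hμk : 0 ≤ μ ^ k := by positivity
    have hc : ‖c (n₀ + k) w‖ ≤ K * μ ^ k := (hKb _ w hw').trans (by gcongr)
    have hak : ‖1 - a ((n₀ + k : ℕ) : ℤ)‖ ≤ C * μ ^ k := (ha _).trans (by gcongr)
    have hG : G (n₀ + k) w (1, 0) = (κ : ℂ)⁻¹ * c (n₀ + k) w := by simp [G]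
    have hκc : (κ : ℂ) ≠ 0 := by exact_mod_cast hκ0.ne'
    have e : T k w (1, 0) - (1, 0) = ((a ((n₀ + k : ℕ) : ℤ))⁻¹ *
        (1 - a ((n₀ + k : ℕ) : ℤ) + c (n₀ + k) w), (κ : ℂ)⁻¹ * c (n₀ + k) w) := by
      refine Prod.ext ?_ ?_
      · simp only [T, hG, Prod.fst_sub]
        have := ha0 ((n₀ + k : ℕ) : ℤ)
        field_simp
        ring
      · simp [T, hG]
    rw [e]
    refine max_le ?_ ?_
    · simp only [norm_mul]
      calc _ ≤ θ * (C * μ ^ k + K * μ ^ k) := by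
            gcongr
            exact (norm_add_le _ _).trans (by gcongr)
        _ = θ * (C + K) * μ ^ k := by ring
        _ ≤ _ := by gcongr; have : 0 ≤ κ⁻¹ * K := by positivity
                    linarith
    · simp only [norm_mul, norm_inv, hnκ]
      calc _ ≤ κ⁻¹ * (K * μ ^ k) := by gcongr
        _ = κ⁻¹ * K * μ ^ k := by ring
        _ ≤ _ := by gcongr; have : 0 ≤ θ * (C + K) := by positivity
                    linarith
  have hdiff : ∀ k (f : ℂ → ℂ × ℂ), DifferentiableOn ℂ f (Metric.ball 0 R) →
      DifferentiableOn ℂ (fun w => T k w (f w)) (Metric.ball 0 R) := by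
    intro k f hf
    have hG : DifferentiableOn ℂ (fun w => G (n₀ + k) w (f w)) (Metric.ball 0 R) := by
      have h1 := hf.fst
      have h2 := hf.snd
      have h3 := (hcd (n₀ + k)).differentiableOn (s := Metric.ball (0 : ℂ) R)
      simp only [G]
      fun_prop
    exact ((hf.fst.add (hG.const_mul _)).const_mul _).prodMk hG
  obtain ⟨S, hSd, hSr, hSl⟩ :=
    exists_backward_orbit Metric.isOpen_ball T (1, 0) hθ0.le hμ.le hθμ' hlip he hdiff
  -- Below `n₀`, `toNat` freezes the sequence at its value at `n₀`; this is why the recursion is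
  -- claimed only from `n₀ + 1` on.
  refine ⟨R, hR1, n₀, fun n => fun w => (S (n - n₀).toNat w).1, fun n => (hSd _).fst, ?_, ?_⟩
  · intro n hn w hw
    obtain ⟨k, rfl⟩ : ∃ k : ℕ, n = n₀ + k + 1 := ⟨(n - n₀ - 1).toNat, by omega⟩
    unfold IsNormalizedSolution
    have i0 : ((n₀ : ℤ) + k + 1 - 1 - n₀).toNat = k := by omega
    have i1 : ((n₀ : ℤ) + k + 1 - n₀).toNat = k + 1 := by omega
    have i2 : ((n₀ : ℤ) + k + 1 + 1 - n₀).toNat = k + 2 := by omega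
    simp only [i0, i1, i2]
    have hκc : (κ : ℂ) ≠ 0 := by exact_mod_cast hκ0.ne'
    have r0 := hSr k w hw
    have r1 := hSr (k + 1) w hw
    have r01 := congrArg Prod.fst r0
    have r02 := congrArg Prod.snd r0
    have r11 := congrArg Prod.fst r1
    have r12 := congrArg Prod.snd r1
    simp only [T] at r01 r02 r11 r12
    rw [← r02] at r01
    rw [← r12] at r11
    have ha1 := ha0 ((n₀ + k : ℕ) : ℤ)
    have ha2 := ha0 ((n₀ + (k + 1) : ℕ) : ℤ)
    rw [eq_inv_mul_iff_mul_eq₀ ha1] at r01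
    rw [eq_inv_mul_iff_mul_eq₀ ha2] at r11
    simp only [G, c] at r02
    have r03 : κ * (S k w).2 = w ^ 4 * a ((n₀ : ℤ) + k + 1) * (κ * (S (k + 1) w).2) +
        (w ^ 4 * (1 - a ((n₀ : ℤ) + k + 1) ^ 2) - jostDefect a p q ((n₀ : ℤ) + k + 1) w) *
          (S (k + 1) w).1 := by
      rw [r02]
      push_cast
      field_simp
    have e1 : (((n₀ + k : ℕ) : ℤ)) = (n₀ : ℤ) + k + 1 - 1 := by push_cast; ring
    have e2 : (((n₀ + (k + 1) : ℕ) : ℤ)) = (n₀ : ℤ) + k + 1 := by push_cast; ring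
    rw [e1] at r01
    rw [e2] at r11
    linear_combination r01 + r03 - w ^ 4 * a ((n₀ : ℤ) + k + 1) * r11
  · intro w hw
    have h1 : Tendsto (fun n : ℕ => S n w) atTop (𝓝 ((1 : ℂ), (0 : ℂ))) := by
      rw [tendsto_iff_norm_sub_tendsto_zero]
      refine squeeze_zero (fun _ => norm_nonneg _) (fun n => hSl n w hw) ?_
      simpa using (hpow.const_mul (κ⁻¹ * K + θ * (C + K))).div_const (1 - θ * μ)
    have h2 : Tendsto (fun n : ℤ => (n - n₀).toNat) atTop atTop :=
      tendsto_atTop.2 fun b => (eventually_ge_atTop ((b : ℤ) + n₀)).mono fun n hn => by omega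
    exact (continuous_fst.tendsto _).comp (h1.comp h2)

/-- The normalized right Jost solution: it depends holomorphically on `w` in a disc of radius
greater than one. -/
theorem exists_normalized_jost {a p q : ℤ → ℂ} (ha0 : ∀ n, a n ≠ 0) {μ C : ℝ}
    (hμ : 0 < μ) (hμ1 : μ < 1)
    (ha : ∀ n : ℕ, ‖1 - a n‖ ≤ C * μ ^ n) (hp : ∀ n : ℕ, ‖p n‖ ≤ C * μ ^ n)
    (hq : ∀ n : ℕ, ‖q n‖ ≤ C * μ ^ n) :
    ∃ R : ℝ, 1 < R ∧ ∃ u : ℤ → ℂ → ℂ,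
      (∀ n, DifferentiableOn ℂ (u n) (Metric.ball 0 R)) ∧
      (∀ n, ∀ w ∈ Metric.ball (0 : ℂ) R, IsNormalizedSolution a p q w (fun k => u k w) n) ∧
      ∀ w ∈ Metric.ball (0 : ℂ) R, Tendsto (fun n : ℤ => u n w) atTop (𝓝 1) := by
  obtain ⟨R, hR, n₀, s, hsd, hsr, hsl⟩ :=
    exists_normalized_solution_near_infinity ha0 hμ hμ1 ha hp hq
  -- The extension is made with values in functions of `w`, so that holomorphy can be carried down
  -- the recursion. Only division by `a (n - 1)` occurs, so the disc does not shrink.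
  obtain ⟨u, hu1, hu2⟩ := exists_backward_extension (fun n (f g : ℂ → ℂ) w =>
    (a (n - 1))⁻¹ * ((1 + w ^ 4 - jostDefect a p q n w) * f w - w ^ 4 * a n * g w)) s n₀
  have hd : ∀ n : ℤ, DifferentiableOn ℂ (u n) (Metric.ball 0 R) := by
    have hge : ∀ n : ℤ, n₀ ≤ n → DifferentiableOn ℂ (u n) (Metric.ball 0 R) := fun n hn => by
      rw [hu1 n hn]; exact hsd n
    have hle : ∀ n : ℤ, n ≤ n₀ → DifferentiableOn ℂ (u n) (Metric.ball 0 R) ∧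
        DifferentiableOn ℂ (u (n + 1)) (Metric.ball 0 R) := by
      intro n hn
      induction n, hn using Int.leInductionDown with
      | base => exact ⟨hge _ le_rfl, hge _ (by omega)⟩
      | pred n hn ih =>
        rw [sub_add_cancel]
        refine ⟨?_, ih.1⟩
        rw [hu2 n hn]
        have h1 := ih.1
        have h2 := ih.2
        have h3 := (differentiable_jostDefect a p q n).differentiableOn
          (s := Metric.ball (0 : ℂ) R)
        fun_prop
    intro n
    rcases le_total (n₀ : ℤ) n with h | h
    · exact hge n h
    · exact (hle n h).1
  refine ⟨R, hR, u, hd, fun n w hw => ?_, fun w hw => ?_⟩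
  · rcases le_or_gt n (n₀ : ℤ) with h | h
    · have := congrFun (hu2 n h) w
      rwa [eq_inv_mul_iff_mul_eq₀ (ha0 _)] at this
    · have := hsr n (by omega) w hw
      simp only [IsNormalizedSolution] at this ⊢
      rwa [hu1 n (by omega), hu1 (n + 1) (by omega), hu1 (n - 1) (by omega)]
  · refine (hsl w hw).congr' ?_
    filter_upwards [eventually_ge_atTop (n₀ : ℤ)] with n hn
    rw [hu1 n hn]

/-! ### Wronskians and solutions of the difference equation -/

section DifferenceEquation

variable {a p q : ℤ → ℂ} {lam : ℂ}

theorem pencil_eq (a p q : ℤ → ℂ) (lam : ℂ) (y : ℤ → ℂ) (n : ℤ) :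
    pencil a p q lam y n = a n * (y (n + 1) - y n) - a (n - 1) * (y n - y (n - 1)) +
      (q n + 2 * lam * p n + lam ^ 2) * y n := by
  simp [pencil, fwdDiff]

/-- Lagrange's identity. -/
theorem pencilWronskian_sub (a p q : ℤ → ℂ) (lam : ℂ) (u v : ℤ → ℂ) (n : ℤ) :
    pencilWronskian a u v n - pencilWronskian a u v (n - 1) =
      u n * pencil a p q lam v n - v n * pencil a p q lam u n := by
  simp only [pencilWronskian, pencil_eq, sub_add_cancel]
  ring

theorem eq_zero_of_tendsto_atTop {f : ℤ → ℂ} {m : ℤ} (h : ∀ n, m < n → f n = f (n - 1))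
    (hf : Tendsto f atTop (𝓝 0)) {n : ℤ} (hn : m ≤ n) : f n = 0 := by
  have hc : ∀ k, m ≤ k → f k = f m := fun k hk => by
    induction k, hk using Int.leInduction with
    | base => rfl
    | succ k hk ih => rw [h (k + 1) (by omega), add_sub_cancel_right, ih]
  have h2 : Tendsto f atTop (𝓝 (f m)) :=
    tendsto_const_nhds.congr' ((eventually_ge_atTop m).mono fun k hk => (hc k hk).symm)
  rw [hc n hn, tendsto_nhds_unique h2 hf]

theorem eq_zero_of_tendsto_atBot {f : ℤ → ℂ} {m : ℤ} (h : ∀ n, n ≤ m → f n = f (n - 1))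
    (hf : Tendsto f atBot (𝓝 0)) {n : ℤ} (hn : n ≤ m) : f n = 0 := by
  have := eq_zero_of_tendsto_atTop (f := fun k => f (-k)) (m := -m)
    (fun k hk => by rw [h (-(k - 1)) (by omega)]; congr 1; ring)
    (hf.comp tendsto_neg_atTop_atBot) (n := -n) (by omega)
  simpa using this

theorem pencilWronskian_eq {u v : ℤ → ℂ} (hu : ∀ n, pencil a p q lam u n = 0)
    (hv : ∀ n, pencil a p q lam v n = 0) (n : ℤ) :
    pencilWronskian a u v n = pencilWronskian a u v (n - 1) := by
  rw [← sub_eq_zero, pencilWronskian_sub a p q lam, hu, hv]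
  ring

/-- A solution vanishing at two consecutive points is zero. -/
theorem solution_eq_zero (ha : ∀ n, a n ≠ 0) {y : ℤ → ℂ}
    (hy : ∀ n, pencil a p q lam y n = 0) {m : ℤ} (h0 : y m = 0) (h1 : y (m + 1) = 0) (n : ℤ) :
    y n = 0 := by
  have hup : ∀ k, m ≤ k → y k = 0 ∧ y (k + 1) = 0 := fun k hk => by
    induction k, hk using Int.leInduction with
    | base => exact ⟨h0, h1⟩
    | succ k hk ih =>
      refine ⟨ih.2, ?_⟩
      have := hy (k + 1)
      rw [pencil_eq, add_sub_cancel_right, ih.1, ih.2] at this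
      simpa [ha] using this
  have hdown : ∀ k, k ≤ m → y k = 0 ∧ y (k + 1) = 0 := fun k hk => by
    induction k, hk using Int.leInductionDown with
    | base => exact ⟨h0, h1⟩
    | pred k hk ih =>
      rw [sub_add_cancel]
      refine ⟨?_, ih.1⟩
      have := hy k
      rw [pencil_eq, ih.1, ih.2] at this
      simpa [ha] using this
  rcases le_total m n with h | h
  · exact (hup n h).1
  · exact (hdown n h).1

theorem exists_eq_mul_of_wronskian_eq_zero (ha : ∀ n, a n ≠ 0) {u v : ℤ → ℂ}
    (hu : ∀ n, pencil a p q lam u n = 0) (hv : ∀ n, pencil a p q lam v n = 0)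
    (hW : ∀ n, pencilWronskian a u v n = 0) {m : ℤ} (hm : v m ≠ 0) :
    ∃ c : ℂ, ∀ n, u n = c * v n := by
  refine ⟨u m / v m, fun n => ?_⟩
  have hd : ∀ n, pencil a p q lam (fun k => u k - u m / v m * v k) n = 0 := fun n => by
    have h1 := hu n
    have h2 := hv n
    rw [pencil_eq] at h1 h2 ⊢
    linear_combination h1 - u m / v m * h2
  refine sub_eq_zero.1 (solution_eq_zero ha hd (m := m) ?_ ?_ n)
  · field_simp
    ring
  · have h := hW m
    simp only [pencilWronskian, mul_eq_zero, ha, false_or] at h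
    field_simp
    linear_combination -h

theorem tendsto_pencilWronskian_zero {l : Filter ℤ} (hl : Tendsto (fun n : ℤ => n + 1) l l)
    (ha : Tendsto a l (𝓝 1)) {y f : ℤ → ℂ} (hy : Tendsto y l (𝓝 0))
    (hf : IsBoundedUnder (· ≤ ·) l (fun n => ‖f n‖)) :
    Tendsto (pencilWronskian a y f) l (𝓝 0) := by
  have hf' : IsBoundedUnder (· ≤ ·) l (fun n => ‖f (n + 1)‖) := by
    obtain ⟨B, hB⟩ := hf
    exact ⟨B, hl.eventually (p := fun n => ‖f n‖ ≤ B) hB⟩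
  have h1 := hy.zero_mul_isBoundedUnder_le hf'
  have h2 := (hy.comp hl).zero_mul_isBoundedUnder_le hf
  have h3 := ha.mul (h1.sub h2)
  rw [sub_zero, mul_zero] at h3
  exact h3

/-- Since `a n` couples the sites `n` and `n + 1`, reflection sends it to `a (-n - 1)`. This
symmetry transfers results at `+∞` to `-∞`. -/
theorem pencil_reflect (a p q : ℤ → ℂ) (lam : ℂ) (y : ℤ → ℂ) (n : ℤ) :
    pencil (fun k => a (-k - 1)) (fun k => p (-k)) (fun k => q (-k)) lam (fun k => y (-k)) n =
      pencil a p q lam y (-n) := by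
  have e1 : -(n + 1) = -n - 1 := by ring
  have e2 : -(n - 1) = -n + 1 := by ring
  simp only [pencil_eq, e1, e2, add_sub_cancel_right]
  ring

theorem tendsto_zero_of_ellTwo (y : EllTwo) :
    Tendsto (fun n => y n) atTop (𝓝 0) ∧ Tendsto (fun n => y n) atBot (𝓝 0) := by
  have h : Tendsto (fun n => y n) cofinite (𝓝 0) := by
    have h1 := ((lp.memℓp y).summable (by norm_num)).tendsto_cofinite_zero
    have h2 := h1.sqrt
    rw [tendsto_zero_iff_norm_tendsto_zero]
    simpa using h2
  rw [Int.cofinite_eq, tendsto_sup] at h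
  exact ⟨h.2, h.1⟩

end DifferenceEquation

/-! ### Exponential decay at the two ends -/

section Jost

variable {a p q : ℤ → ℂ}

/-- Exponential decay of the perturbation towards `+∞`. -/
def DecaysRight (a p q : ℤ → ℂ) : Prop :=
  ∃ μ C : ℝ, 0 < μ ∧ μ < 1 ∧ ∀ n : ℕ, ‖1 - a n‖ ≤ C * μ ^ n ∧ ‖p n‖ ≤ C * μ ^ n ∧ ‖q n‖ ≤ C * μ ^ n

theorem DecaysRight.tendsto (h : DecaysRight a p q) : Tendsto a atTop (𝓝 1) := by
  obtain ⟨μ, C, hμ, hμ1, h⟩ := h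
  have hpow : Tendsto (fun n : ℕ => μ ^ n) atTop (𝓝 0) :=
    tendsto_pow_atTop_nhds_zero_of_lt_one hμ.le hμ1
  have h1 : Tendsto (fun n : ℕ => 1 - a n) atTop (𝓝 0) :=
    squeeze_zero_norm (fun n => (h n).1) (by simpa using hpow.const_mul C)
  have h2 : Tendsto (fun n : ℕ => a n) atTop (𝓝 1) := by simpa using h1.const_sub 1
  have h3 : Tendsto Int.toNat atTop atTop :=
    tendsto_atTop.2 fun b => (eventually_ge_atTop (b : ℤ)).mono fun n hn => by omega
  refine (h2.comp h3).congr' ((eventually_ge_atTop 0).mono fun n hn => ?_)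
  simp [Int.toNat_of_nonneg hn]

theorem decaysRight_of_bddAbove {ε : ℝ} (hε : 0 < ε)
    (h : BddAbove (Set.range fun n : ℤ =>
      Real.exp (ε * |(n : ℝ)|) * (‖1 - a n‖ + ‖p n‖ + ‖q n‖))) :
    DecaysRight a p q ∧
      DecaysRight (fun k => a (-k - 1)) (fun k => p (-k)) (fun k => q (-k)) := by
  obtain ⟨C, hC⟩ := h
  have hC : ∀ n : ℤ, ‖1 - a n‖ + ‖p n‖ + ‖q n‖ ≤ C * Real.exp (-ε) ^ n.natAbs := by
    intro n
    have h1 : Real.exp (ε * |(n : ℝ)|) * (‖1 - a n‖ + ‖p n‖ + ‖q n‖) ≤ C := hC ⟨n, rfl⟩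
    have h2 : Real.exp (-ε) ^ n.natAbs = (Real.exp (ε * |(n : ℝ)|))⁻¹ := by
      rw [← Real.exp_nat_mul, ← Real.exp_neg]
      congr 1
      rw [Nat.cast_natAbs, Int.cast_abs]
      ring
    rw [h2, ← div_eq_mul_inv, le_div_iff₀ (Real.exp_pos _)]
    linarith
  have hC0 : 0 ≤ C := by
    have := hC 0
    simp only [Int.natAbs_zero, pow_zero, mul_one] at this
    exact le_trans (by positivity) this
  have hμ1 : Real.exp (-ε) < 1 := by simpa using hε
  refine ⟨⟨Real.exp (-ε), C, Real.exp_pos _, hμ1, fun n => ?_⟩,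
    ⟨Real.exp (-ε), C, Real.exp_pos _, hμ1, fun n => ?_⟩⟩
  · have h1 := hC n
    rw [Int.natAbs_natCast] at h1
    have := norm_nonneg (1 - a n)
    have := norm_nonneg (p n)
    have := norm_nonneg (q n)
    refine ⟨?_, ?_, ?_⟩ <;> linarith
  · have h1 := hC (-n)
    have h2 := hC (-n - 1)
    rw [Int.natAbs_neg, Int.natAbs_natCast] at h1
    rw [show (-(n : ℤ) - 1).natAbs = n + 1 by omega] at h2
    have h3 : C * Real.exp (-ε) ^ (n + 1) ≤ C * Real.exp (-ε) ^ n :=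
      mul_le_mul_of_nonneg_left
        (pow_le_pow_of_le_one (Real.exp_pos _).le hμ1.le (Nat.le_succ n)) hC0
    have := norm_nonneg (1 - a (-n))
    have := norm_nonneg (p (-n))
    have := norm_nonneg (q (-n))
    have := norm_nonneg (1 - a (-n - 1))
    have := norm_nonneg (p (-n - 1))
    have := norm_nonneg (q (-n - 1))
    refine ⟨?_, ?_, ?_⟩ <;> linarith

/-! ### Jost solutions in the variable `w = e^{iz/2}` -/

/-- The uniformizing parameter `w = e^{iz/2}`, for which `λ = 2 cos (z / 2) = w + w⁻¹`. -/
noncomputable def halfExp (z : ℂ) : ℂ := Complex.exp (Complex.I * z / 2)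

theorem halfExp_ne_zero (z : ℂ) : halfExp z ≠ 0 := Complex.exp_ne_zero _

theorem differentiable_halfExp : Differentiable ℂ halfExp := by
  unfold halfExp
  fun_prop

theorem halfExp_sq (z : ℂ) : halfExp z ^ 2 = Complex.exp (Complex.I * z) := by
  rw [halfExp, ← Complex.exp_nat_mul]
  congr 1
  push_cast
  ring

theorem two_mul_cos_eq (z : ℂ) : 2 * Complex.cos (z / 2) = halfExp z + (halfExp z)⁻¹ := by
  rw [halfExp, ← Complex.exp_neg, Complex.cos]
  have e1 : z / 2 * Complex.I = Complex.I * z / 2 := by ring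
  have e2 : -(z / 2) * Complex.I = -(Complex.I * z / 2) := by ring
  rw [e1, e2]
  ring

theorem norm_halfExp (z : ℂ) : ‖halfExp z‖ = Real.exp (-(z.im / 2)) := by
  rw [halfExp, Complex.norm_exp]
  congr 1
  simp [neg_div]

theorem norm_halfExp_le_one {z : ℂ} (hz : 0 ≤ z.im) : ‖halfExp z‖ ≤ 1 := by
  rw [norm_halfExp, Real.exp_le_one_iff]
  linarith

theorem neg_halfExp_sq_zpow (z : ℂ) (n : ℤ) :
    (-(halfExp z ^ 2)) ^ n = (-1 : ℂ) ^ n * Complex.exp (Complex.I * n * z) := by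
  rw [neg_eq_neg_one_mul, mul_zpow, halfExp_sq, ← Complex.exp_int_mul]
  congr 2
  ring

theorem normalizer_mul_zpow (z : ℂ) (n : ℤ) :
    (-1 : ℂ) ^ n * Complex.exp (-(Complex.I * n * z)) * (-(halfExp z ^ 2)) ^ n = 1 := by
  rw [neg_halfExp_sq_zpow, Complex.exp_neg]
  have h1 : (-1 : ℂ) ^ n * (-1 : ℂ) ^ n = 1 := by rw [← mul_zpow]; simp
  have := Complex.exp_ne_zero (Complex.I * n * z)
  field_simp
  rw [pow_two, h1]

theorem pencil_eq_zero_of_isNormalizedSolution {w lam : ℂ} (hw : w ≠ 0) (hlam : lam = w + w⁻¹)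
    {u : ℤ → ℂ} {n : ℤ} (h : IsNormalizedSolution a p q w u n) :
    pencil a p q lam (fun k => (-(w ^ 2)) ^ k * u k) n = 0 := by
  have hx : -(w ^ 2) ≠ 0 := by simpa using hw
  have hl : lam * w = w ^ 2 + 1 := by rw [hlam]; field_simp
  obtain ⟨k, rfl⟩ : ∃ k, n = k + 1 := ⟨n - 1, by ring⟩
  unfold IsNormalizedSolution jostDefect at h
  rw [pencil_eq]
  simp only [add_sub_cancel_right] at h ⊢
  rw [zpow_add_one₀ hx (k + 1), zpow_add_one₀ hx k]
  linear_combination (-(w ^ 2)) ^ k * h +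
    (-(w ^ 2)) ^ k * u (k + 1) * (-2 * p (k + 1) * w - (lam * w + w ^ 2 + 1)) * hl

theorem norm_le_norm_normalizer_mul {z : ℂ} (hz : 0 ≤ z.im) {n : ℤ} (hn : 0 ≤ n) (y : ℂ) :
    ‖y‖ ≤ ‖(-1 : ℂ) ^ n * Complex.exp (-(Complex.I * n * z)) * y‖ := by
  rw [norm_mul]
  refine le_mul_of_one_le_left (norm_nonneg _) ?_
  rw [norm_mul, norm_zpow, norm_neg, norm_one, one_zpow, one_mul, Complex.norm_exp,
    Real.one_le_exp_iff]
  simp only [Complex.neg_re, Complex.mul_re, Complex.mul_im, Complex.I_re, Complex.I_im,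
    Complex.intCast_re, Complex.intCast_im]
  have : (0 : ℝ) ≤ n := by exact_mod_cast hn
  nlinarith [mul_nonneg this hz]

theorem IsJostRight.isBoundedUnder {z : ℂ} (hz : 0 ≤ z.im) {f : ℤ → ℂ}
    (hf : IsJostRight a p q z f) : IsBoundedUnder (· ≤ ·) atTop (fun n => ‖f n‖) := by
  have h1 := hf.2.norm.eventually_le_const (u := 2) (by simp)
  refine ⟨2, eventually_map.2 ?_⟩
  filter_upwards [h1, eventually_ge_atTop 0] with n hn hn0
  exact (norm_le_norm_normalizer_mul hz hn0 _).trans hn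

theorem IsJostRight.exists_ne_zero {z : ℂ} {f : ℤ → ℂ} (hf : IsJostRight a p q z f) :
    ∃ m, f m ≠ 0 := by
  obtain ⟨m, hm⟩ := (hf.2.eventually_ne one_ne_zero).exists
  exact ⟨m, right_ne_zero_of_mul hm⟩

/-- A solution tending to zero at `+∞` is a multiple of the right Jost solution. -/
theorem IsJostRight.exists_eq_mul (ha : ∀ n, a n ≠ 0) (ha1 : Tendsto a atTop (𝓝 1)) {z : ℂ}
    (hz : 0 ≤ z.im) {f y : ℤ → ℂ} (hf : IsJostRight a p q z f)
    (hy : ∀ n, pencil a p q (2 * Complex.cos (z / 2)) y n = 0) (hy0 : Tendsto y atTop (𝓝 0)) :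
    ∃ c : ℂ, ∀ n, y n = c * f n := by
  obtain ⟨m, hm⟩ := hf.exists_ne_zero
  refine exists_eq_mul_of_wronskian_eq_zero ha hy hf.1 (fun n => ?_) hm
  exact eq_zero_of_tendsto_atTop (m := n) (fun k _ => pencilWronskian_eq hy hf.1 k)
    (tendsto_pencilWronskian_zero (tendsto_atTop_add_const_right _ _ tendsto_id) ha1 hy0
      (hf.isBoundedUnder hz)) le_rfl

/-- The normalizing factor has modulus at least one for `n ≥ 0`, so the difference of two candidates
tends to zero and is a multiple `c g` of one of them. After normalization it tends both to `c` and
to `0`. -/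
theorem IsJostRight.unique (ha : ∀ n, a n ≠ 0) (ha1 : Tendsto a atTop (𝓝 1)) {z : ℂ}
    (hz : 0 ≤ z.im) {f g : ℤ → ℂ} (hf : IsJostRight a p q z f) (hg : IsJostRight a p q z g) :
    f = g := by
  have hd : ∀ n, pencil a p q (2 * Complex.cos (z / 2)) (fun k => f k - g k) n = 0 := fun n => by
    have h1 := hf.1 n
    have h2 := hg.1 n
    rw [pencil_eq] at h1 h2 ⊢
    linear_combination h1 - h2
  have hlim := hf.2.sub hg.2
  simp only [← mul_sub, sub_self] at hlim
  have hd0 : Tendsto (fun k => f k - g k) atTop (𝓝 0) := by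
    rw [tendsto_zero_iff_norm_tendsto_zero] at hlim ⊢
    refine squeeze_zero' (Eventually.of_forall fun _ => norm_nonneg _) ?_ hlim
    filter_upwards [eventually_ge_atTop 0] with n hn0
    exact norm_le_norm_normalizer_mul hz hn0 _
  obtain ⟨c, hc⟩ := hg.exists_eq_mul ha ha1 hz hd hd0
  have hc0 : c = 0 := by
    have h2 := hg.2.const_mul c
    rw [mul_one] at h2
    refine tendsto_nhds_unique (h2.congr fun n => ?_) hlim
    rw [hc n]
    ring
  funext n
  have := hc n
  rw [hc0, zero_mul] at this
  exact sub_eq_zero.1 this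

theorem isJostLeft_iff_reflect {z : ℂ} {y : ℤ → ℂ} :
    IsJostLeft a p q z y ↔ IsJostRight (fun k => a (-k - 1)) (fun k => p (-k)) (fun k => q (-k)) z
      (fun k => y (-k)) := by
  unfold IsJostLeft IsJostRight
  refine and_congr ⟨fun h n => by rw [pencil_reflect, h], fun h n => ?_⟩ ?_
  · have := h (-n)
    rwa [pencil_reflect, neg_neg] at this
  · have e : (fun n : ℤ => (-1 : ℂ) ^ n * Complex.exp (-(Complex.I * n * z)) * y (-n)) =
        (fun n : ℤ => (-1 : ℂ) ^ n * Complex.exp (Complex.I * n * z) * y n) ∘ Neg.neg := by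
      funext n
      simp only [Function.comp, Int.cast_neg]
      congr 2
      · rw [zpow_neg, ← inv_zpow, inv_neg, inv_one]
      · congr 1
        ring
    rw [e]
    refine ⟨fun h => h.comp tendsto_neg_atTop_atBot, fun h => ?_⟩
    refine (h.comp tendsto_neg_atBot_atTop).congr fun n => ?_
    simp only [Function.comp, neg_neg]

/-- For `Im z ≥ 0` the right Jost solution is `x ^ n u_n(w)` with `x = -w²`, `w = e^{iz/2}` and
`u_n` holomorphic in a disc of radius greater than one. -/
theorem exists_jostRight_eq (ha : ∀ n, a n ≠ 0) (hd : DecaysRight a p q) :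
    ∃ R : ℝ, 1 < R ∧ ∃ u : ℤ → ℂ → ℂ,
      (∀ n, DifferentiableOn ℂ (u n) (Metric.ball 0 R)) ∧ (∀ n, u n 0 ≠ 0) ∧
      ∀ z : ℂ, 0 ≤ z.im →
        IsJostRight a p q z (fun n => (-(halfExp z ^ 2)) ^ n * u n (halfExp z)) := by
  obtain ⟨μ, C, hμ, hμ1, h⟩ := hd
  obtain ⟨R, hR, u, hud, hus, hul⟩ := exists_normalized_jost ha hμ hμ1 (fun n => (h n).1)
    (fun n => (h n).2.1) (fun n => (h n).2.2)
  refine ⟨R, hR, u, hud, fun n hn => ?_, fun z hz => ?_⟩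
  -- At `w = 0` the recursion degenerates to `a_{n-1} u_{n-1} = u_n`, so a zero would propagate to
  -- `+∞`, against the limit 1.
  · have h0 : (0 : ℂ) ∈ Metric.ball (0 : ℂ) R := Metric.mem_ball_self (by linarith)
    have hz : ∀ k, n ≤ k → u k 0 = 0 := fun k hk => by
      induction k, hk using Int.leInduction with
      | base => exact hn
      | succ k hk ih =>
        have := hus (k + 1) 0 h0
        simpa [IsNormalizedSolution, jostDefect, ih] using this.symm
    have h1 : Tendsto (fun k : ℤ => u k 0) atTop (𝓝 0) :=
      tendsto_const_nhds.congr' ((eventually_ge_atTop n).mono fun k hk => (hz k hk).symm)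
    exact one_ne_zero (tendsto_nhds_unique (hul 0 h0) h1)
  · have hw : halfExp z ∈ Metric.ball (0 : ℂ) R := by
      simpa using (norm_halfExp_le_one hz).trans_lt hR
    refine ⟨fun n => pencil_eq_zero_of_isNormalizedSolution (halfExp_ne_zero z)
      (two_mul_cos_eq z) (hus n _ hw), ?_⟩
    refine (hul _ hw).congr fun n => ?_
    rw [← mul_assoc, normalizer_mul_zpow, one_mul]

/-- For `Im z ≥ 0` the left Jost solution is `x ^ (-n) v_n(w)` with `x = -w²`, `w = e^{iz/2}` and
`v_n` holomorphic in a disc of radius greater than one. -/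
theorem exists_jostLeft_eq (ha : ∀ n, a n ≠ 0)
    (hd : DecaysRight (fun k => a (-k - 1)) (fun k => p (-k)) (fun k => q (-k))) :
    ∃ R : ℝ, 1 < R ∧ ∃ v : ℤ → ℂ → ℂ,
      (∀ n, DifferentiableOn ℂ (v n) (Metric.ball 0 R)) ∧ (∀ n, v n 0 ≠ 0) ∧
      ∀ z : ℂ, 0 ≤ z.im →
        IsJostLeft a p q z (fun n => (-(halfExp z ^ 2)) ^ (-n) * v n (halfExp z)) := by
  obtain ⟨R, hR, u, hud, hu0, hu⟩ := exists_jostRight_eq (fun n => ha _) hd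
  refine ⟨R, hR, fun n => u (-n), fun n => hud _, fun n => hu0 _, fun z hz => ?_⟩
  rw [isJostLeft_iff_reflect]
  simpa using hu z hz

/-! ### Eigenvalues and the resolvent kernel in terms of `Φ` -/

/-- The hypotheses on the coefficients used below: nonvanishing and decay at both ends. -/
structure IsAdmissible (a p q : ℤ → ℂ) : Prop where
  ne_zero : ∀ n, a n ≠ 0
  right : DecaysRight a p q
  left : DecaysRight (fun k => a (-k - 1)) (fun k => p (-k)) (fun k => q (-k))

theorem IsAdmissible.tendsto_atBot (h : IsAdmissible a p q) : Tendsto a atBot (𝓝 1) := by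
  have h1 : Tendsto (fun n : ℤ => -n - 1) atBot atTop :=
    tendsto_atTop_add_const_right _ (-1) tendsto_neg_atBot_atTop
  refine (h.left.tendsto.comp h1).congr fun n => ?_
  simp [Function.comp]

theorem IsAdmissible.isJostRight_jostRight (h : IsAdmissible a p q) {z : ℂ} (hz : 0 ≤ z.im) :
    IsJostRight a p q z (jostRight a p q z) := by
  obtain ⟨R, hR, u, hud, hu0, hu⟩ := exists_jostRight_eq h.ne_zero h.right
  exact Classical.epsilon_spec ⟨_, hu z hz⟩

theorem IsAdmissible.isJostLeft_jostLeft (h : IsAdmissible a p q) {z : ℂ} (hz : 0 ≤ z.im) :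
    IsJostLeft a p q z (jostLeft a p q z) := by
  obtain ⟨R, hR, u, hud, hu0, hu⟩ := exists_jostLeft_eq h.ne_zero h.left
  exact Classical.epsilon_spec ⟨_, hu z hz⟩

theorem IsAdmissible.eq_jostRight (h : IsAdmissible a p q) {z : ℂ} (hz : 0 ≤ z.im) {f : ℤ → ℂ}
    (hf : IsJostRight a p q z f) : jostRight a p q z = f :=
  (h.isJostRight_jostRight hz).unique h.ne_zero h.right.tendsto hz hf

theorem IsAdmissible.eq_jostLeft (h : IsAdmissible a p q) {z : ℂ} (hz : 0 ≤ z.im) {f : ℤ → ℂ}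
    (hf : IsJostLeft a p q z f) : jostLeft a p q z = f := by
  have := (isJostLeft_iff_reflect.1 (h.isJostLeft_jostLeft hz)).unique (fun n => h.ne_zero _)
    h.left.tendsto hz (isJostLeft_iff_reflect.1 hf)
  funext n
  simpa using congrFun this (-n)

theorem IsJostLeft.isBoundedUnder {z : ℂ} (hz : 0 ≤ z.im) {f : ℤ → ℂ}
    (hf : IsJostLeft a p q z f) : IsBoundedUnder (· ≤ ·) atBot (fun n => ‖f n‖) := by
  obtain ⟨B, hB⟩ := (isJostLeft_iff_reflect.1 hf).isBoundedUnder hz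
  refine ⟨B, eventually_map.2 ?_⟩
  simpa using tendsto_neg_atBot_atTop.eventually (eventually_map.1 hB)

theorem IsJostLeft.exists_eq_mul (h : IsAdmissible a p q) {z : ℂ} (hz : 0 ≤ z.im) {f y : ℤ → ℂ}
    (hf : IsJostLeft a p q z f) (hy : ∀ n, pencil a p q (2 * Complex.cos (z / 2)) y n = 0)
    (hy0 : Tendsto y atBot (𝓝 0)) : ∃ c : ℂ, ∀ n, y n = c * f n := by
  obtain ⟨c, hc⟩ := (isJostLeft_iff_reflect.1 hf).exists_eq_mul (fun n => h.ne_zero _)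
    h.left.tendsto hz (y := fun n => y (-n)) (fun n => by rw [pencil_reflect, hy])
    (hy0.comp tendsto_neg_atTop_atBot)
  exact ⟨c, fun n => by simpa using hc (-n)⟩

theorem IsAdmissible.pencilWronskian_eq_jostPhi (h : IsAdmissible a p q) {z : ℂ}
    (hz : 0 ≤ z.im) (n : ℤ) :
    pencilWronskian a (jostLeft a p q z) (jostRight a p q z) n = jostPhi a p q z := by
  have hstep := pencilWronskian_eq (h.isJostLeft_jostLeft hz).1 (h.isJostRight_jostRight hz).1
  induction n using Int.induction_on with
  | zero => rfl
  | succ n ih => rw [hstep, add_sub_cancel_right, ih]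
  | pred n ih => rw [← hstep, ih]

/-- An `ℓ²` solution forces `Im z > 0` and `Φ(z) = 0`. -/
theorem IsAdmissible.jostPhi_eq_zero_of_ellTwo (h : IsAdmissible a p q) {z : ℂ} (hz : 0 ≤ z.im)
    {y : EllTwo} (hy0 : y ≠ 0) (hy : ∀ n, pencil a p q (2 * Complex.cos (z / 2)) y n = 0) :
    0 < z.im ∧ jostPhi a p q z = 0 := by
  have hr := h.isJostRight_jostRight hz
  have hl := h.isJostLeft_jostLeft hz
  obtain ⟨htop, hbot⟩ := tendsto_zero_of_ellTwo y
  obtain ⟨c, hc⟩ := hr.exists_eq_mul h.ne_zero h.right.tendsto hz hy htop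
  obtain ⟨d, hd⟩ := hl.exists_eq_mul h hz hy hbot
  have hcne : c ≠ 0 := fun h0 => hy0 (lp.ext (funext fun n => by simp [hc, h0]))
  have hdne : d ≠ 0 := fun h0 => hy0 (lp.ext (funext fun n => by simp [hd, h0]))
  constructor
  -- For real `z` the right Jost solution has modulus tending to 1, so no nonzero multiple of it
  -- tends to zero.
  · refine lt_of_le_of_ne hz fun him => ?_
    have h1 : Tendsto (fun n => c * jostRight a p q z n) atTop (𝓝 0) := by
      simpa only [← hc] using htop
    have h2 : Tendsto (fun n => jostRight a p q z n) atTop (𝓝 0) := by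
      simpa [hcne] using h1.const_mul c⁻¹
    have h3 := hr.2.norm
    have h4 : Tendsto (fun n => ‖jostRight a p q z n‖) atTop (𝓝 1) := by
      rw [norm_one] at h3
      refine h3.congr fun n => ?_
      rw [norm_mul, norm_mul, norm_zpow, norm_neg, norm_one, one_zpow, one_mul, Complex.norm_exp]
      simp [← him]
    have h5 := tendsto_nhds_unique h4 h2.norm
    simp at h5
  · have hprop : ∀ n, jostLeft a p q z n = d⁻¹ * c * jostRight a p q z n := fun n => by
      rw [mul_assoc, ← hc n, hd n, inv_mul_cancel_left₀ hdne]
    rw [jostPhi, pencilWronskian, hprop, hprop]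
    ring

/-- The kernel of the resolvent is built from the Jost solutions, up to the factor `Φ`. -/
theorem IsAdmissible.resolvent_kernel_mul (h : IsAdmissible a p q) {z : ℂ} (hz : 0 ≤ z.im)
    {R : EllTwo →L[ℂ] EllTwo} (hR : IsPencilResolvent a p q (2 * Complex.cos (z / 2)) R)
    (n m : ℤ) :
    R (lp.single 2 m (1 : ℂ)) n * jostPhi a p q z =
      if m ≤ n then jostRight a p q z n * jostLeft a p q z m
      else jostLeft a p q z n * jostRight a p q z m := by
  set y : EllTwo := R (lp.single 2 m (1 : ℂ)) with hy
  set r := jostRight a p q z with hrdef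
  set l := jostLeft a p q z with hldef
  have hr : IsJostRight a p q z r := h.isJostRight_jostRight hz
  have hl : IsJostLeft a p q z l := h.isJostLeft_jostLeft hz
  have hLy : ∀ k, k ≠ m → pencil a p q (2 * Complex.cos (z / 2)) y k = 0 := fun k hk => by
    rw [hy, hR.1, lp.single_apply_ne _ _ _ hk]
  have hLym : pencil a p q (2 * Complex.cos (z / 2)) y m = 1 := by
    rw [hy, hR.1, lp.single_apply_self]
  obtain ⟨htop, hbot⟩ := tendsto_zero_of_ellTwo y
  have hstep : ∀ f : ℤ → ℂ, (∀ k, pencil a p q (2 * Complex.cos (z / 2)) f k = 0) →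
      ∀ k, k ≠ m → pencilWronskian a y f k = pencilWronskian a y f (k - 1) := fun f hf k hk => by
    rw [← sub_eq_zero, pencilWronskian_sub a p q (2 * Complex.cos (z / 2)), hf, hLy k hk]
    ring
  have hjump : ∀ f : ℤ → ℂ, (∀ k, pencil a p q (2 * Complex.cos (z / 2)) f k = 0) →
      pencilWronskian a y f m - pencilWronskian a y f (m - 1) = -f m := fun f hf => by
    rw [pencilWronskian_sub a p q (2 * Complex.cos (z / 2)), hf, hLym]
    ring
  have hWr : ∀ k, m ≤ k → pencilWronskian a y r k = 0 := fun k hk =>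
    eq_zero_of_tendsto_atTop (m := m) (fun k hk => hstep r hr.1 k hk.ne')
      (tendsto_pencilWronskian_zero (tendsto_atTop_add_const_right _ _ tendsto_id)
        h.right.tendsto htop (hr.isBoundedUnder hz)) hk
  have hWl : ∀ k, k ≤ m - 1 → pencilWronskian a y l k = 0 := fun k hk =>
    eq_zero_of_tendsto_atBot (m := m - 1) (fun k hk => hstep l hl.1 k (by omega))
      (tendsto_pencilWronskian_zero (tendsto_atBot_add_const_right _ _ tendsto_id)
        h.tendsto_atBot hbot (hl.isBoundedUnder hz)) hk
  have hWl' : ∀ k, m ≤ k → pencilWronskian a y l k = -l m := fun k hk => by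
    induction k, hk using Int.leInduction with
    | base => rw [← hjump l hl.1, hWl (m - 1) le_rfl, sub_zero]
    | succ k hk ih => rw [hstep l hl.1 (k + 1) (by omega), add_sub_cancel_right, ih]
  have hWr' : ∀ k, k ≤ m - 1 → pencilWronskian a y r k = r m := fun k hk => by
    induction k, hk using Int.leInductionDown with
    | base =>
      have := hjump r hr.1
      rw [hWr m le_rfl, zero_sub] at this
      exact neg_inj.1 this
    | pred k hk ih => rw [← hstep r hr.1 k (by omega), ih]
  -- The Plücker identity among `y`, `l`, `r`. On each side of `m` one of the two Wronskians
  -- vanishes by decay and the other is fixed by the jump at `m`.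
  have key : y n * jostPhi a p q z =
      l n * pencilWronskian a y r n - r n * pencilWronskian a y l n := by
    rw [← h.pencilWronskian_eq_jostPhi hz n, ← hrdef, ← hldef]
    simp only [pencilWronskian]
    ring
  rw [key]
  split_ifs with hnm
  · rw [hWr n hnm, hWl' n hnm]
    ring
  · rw [hWr' n (by omega), hWl n (by omega)]
    ring

/-! ### Analytic continuation of `Φ`, its zeros and the poles of the kernel -/

/-- Holomorphic continuation of the Jost solutions and of `Φ`. -/
theorem IsAdmissible.exists_continuation (h : IsAdmissible a p q) :
    ∃ R : ℝ, 1 < R ∧ ∃ Ψ : ℂ → ℂ, DifferentiableOn ℂ Ψ (Metric.ball 0 R) ∧ Ψ 0 ≠ 0 ∧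
      (∀ z : ℂ, 0 ≤ z.im → jostPhi a p q z = -Ψ (halfExp z) / halfExp z ^ 2) ∧
      ∃ r l : ℤ → ℂ → ℂ, ∀ z : ℂ, 0 ≤ z.im → ∀ n,
        ContinuousAt (r n) z ∧ ContinuousAt (l n) z ∧
          jostRight a p q z n = r n z ∧ jostLeft a p q z n = l n z := by
  obtain ⟨R₁, hR₁, u, hud, hu0, hu⟩ := exists_jostRight_eq h.ne_zero h.right
  obtain ⟨R₂, hR₂, v, hvd, hv0, hv⟩ := exists_jostLeft_eq h.ne_zero h.left
  have hud' : ∀ n, DifferentiableOn ℂ (u n) (Metric.ball 0 (min R₁ R₂)) := fun n =>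
    (hud n).mono (Metric.ball_subset_ball (min_le_left _ _))
  have hvd' : ∀ n, DifferentiableOn ℂ (v n) (Metric.ball 0 (min R₁ R₂)) := fun n =>
    (hvd n).mono (Metric.ball_subset_ball (min_le_right _ _))
  have hR : 1 < min R₁ R₂ := lt_min hR₁ hR₂
  have hmem : ∀ z : ℂ, 0 ≤ z.im → Metric.ball 0 (min R₁ R₂) ∈ 𝓝 (halfExp z) := fun z hz =>
    Metric.isOpen_ball.mem_nhds (by simpa using (norm_halfExp_le_one hz).trans_lt hR)
  have hx : ∀ (z : ℂ) (n : ℤ), ContinuousAt (fun z => (-(halfExp z ^ 2)) ^ n) z := fun z n =>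
    ((differentiable_halfExp.continuous.pow 2).neg.continuousAt).zpow₀ n
      (Or.inl (neg_ne_zero.2 (pow_ne_zero _ (halfExp_ne_zero z))))
  refine ⟨min R₁ R₂, hR, fun w => a 0 * (w ^ 4 * v 0 w * u 1 w - v 1 w * u 0 w), ?_, ?_, ?_,
    fun n z => (-(halfExp z ^ 2)) ^ n * u n (halfExp z),
    fun n z => (-(halfExp z ^ 2)) ^ (-n) * v n (halfExp z), fun z hz n => ⟨?_, ?_, ?_, ?_⟩⟩
  · have h1 := hud' 0
    have h2 := hud' 1
    have h3 := hvd' 0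
    have h4 := hvd' 1
    fun_prop
  · simp [h.ne_zero, hu0, hv0]
  · intro z hz
    rw [jostPhi, pencilWronskian, h.eq_jostRight hz (hu z hz), h.eq_jostLeft hz (hv z hz)]
    have := halfExp_ne_zero z
    simp only [zero_add, zpow_zero, neg_zero, zpow_one, zpow_neg, one_mul]
    field_simp
    ring
  · exact (hx z n).mul (ContinuousAt.comp (f := halfExp)
      ((hud' n).continuousOn.continuousAt (hmem z hz))
      differentiable_halfExp.continuous.continuousAt)
  · exact (hx z (-n)).mul (ContinuousAt.comp (f := halfExp)
      ((hvd' n).continuousOn.continuousAt (hmem z hz))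
      differentiable_halfExp.continuous.continuousAt)
  · rw [h.eq_jostRight hz (hu z hz)]
  · rw [h.eq_jostLeft hz (hv z hz)]

/-- The zeros of a holomorphic function, nonzero at the origin, in a smaller closed disc are
finitely many. -/
theorem finite_zeros_of_differentiableOn_ball {R s : ℝ} (hR : s < R) (hs : 0 ≤ s) {Ψ : ℂ → ℂ}
    (hΨ : DifferentiableOn ℂ Ψ (Metric.ball 0 R)) (h0 : Ψ 0 ≠ 0) :
    {w | ‖w‖ ≤ s ∧ Ψ w = 0}.Finite := by
  by_contra hinf
  obtain ⟨w, hw, hacc⟩ := Set.Infinite.exists_accPt_of_subset_isCompact hinf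
    (isCompact_closedBall (0 : ℂ) s) fun w hw => by simpa using hw.1
  rw [accPt_iff_frequently_nhdsNE] at hacc
  have han := hΨ.analyticOnNhd Metric.isOpen_ball
  have hw' : w ∈ Metric.ball (0 : ℂ) R := Metric.closedBall_subset_ball hR hw
  exact h0 (han.eqOn_zero_of_preconnected_of_frequently_eq_zero
    (convex_ball (0 : ℂ) R).isPreconnected hw' (hacc.mono fun _ h => h.2)
    (Metric.mem_ball_self (by linarith)))

theorem IsAdmissible.hasZeroOrder (h : IsAdmissible a p q) {z : ℂ} (hz : 0 ≤ z.im)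
    (hΦ : jostPhi a p q z = 0) : ∃ m : ℕ, 0 < m ∧ HasZeroOrder (jostPhi a p q) z m := by
  obtain ⟨R, hR, Ψ, hΨ, hΨ0, hΦΨ, -⟩ := h.exists_continuation
  have han := hΨ.analyticOnNhd Metric.isOpen_ball
  have hw : halfExp z ∈ Metric.ball (0 : ℂ) R := by
    simpa using (norm_halfExp_le_one hz).trans_lt hR
  let F : ℂ → ℂ := fun z => -Ψ (halfExp z) / halfExp z ^ 2
  have hexp : AnalyticAt ℂ halfExp z := differentiable_halfExp.analyticAt z
  have hF : AnalyticAt ℂ F z :=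
    (((han _ hw).comp hexp).neg).div (hexp.pow 2) (pow_ne_zero _ (halfExp_ne_zero z))
  have hFz : F z = 0 := by rw [← hΦ, hΦΨ z hz]
  have htop : analyticOrderAt F z ≠ ⊤ := by
    rw [Ne, analyticOrderAt_eq_top]
    intro hev
    -- `halfExp` is a local homeomorphism, so vanishing near `z` gives vanishing of `Ψ` near
    -- `halfExp z`; the identity theorem then contradicts `Ψ 0 ≠ 0`.
    have hderiv : HasStrictDerivAt halfExp (halfExp z * (Complex.I / 2)) z := by
      have h1 : HasStrictDerivAt (fun z : ℂ => Complex.I * z / 2) (Complex.I / 2) z := by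
        simpa using ((hasStrictDerivAt_id z).const_mul Complex.I).div_const 2
      exact h1.cexp
    have hmap := hderiv.map_nhds_eq (by simp [halfExp_ne_zero])
    have hev' : ∀ᶠ w in 𝓝 (halfExp z), Ψ w = 0 := by
      rw [← hmap, eventually_map]
      filter_upwards [hev] with x hx
      simpa [F, halfExp_ne_zero] using hx
    exact hΨ0 (han.eqOn_zero_of_preconnected_of_eventuallyEq_zero
      (convex_ball (0 : ℂ) R).isPreconnected hw hev' (Metric.mem_ball_self (by linarith)))
  obtain ⟨m, hm⟩ := ENat.ne_top_iff_exists.1 htop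
  refine ⟨m, Nat.pos_of_ne_zero ?_, F, hF, ?_, hm.symm⟩
  · rintro rfl
    exact hF.analyticOrderAt_ne_zero.2 hFz hm.symm
  · filter_upwards [self_mem_nhdsWithin] with x hx
    exact (hΦΨ x hx).symm

/-- If `Φ(z₀) ≠ 0`, the kernel is a quotient with a finite limit as `z → z₀` from above, whereas a
pole makes its modulus tend to infinity. -/
theorem IsAdmissible.jostPhi_eq_zero_of_pole (h : IsAdmissible a p q) {z₀ : ℂ} (hz₀ : z₀.im = 0)
    (hpole : ResolventKernelHasPole a p q z₀) : jostPhi a p q z₀ = 0 := by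
  by_contra hne
  obtain ⟨n, m, G, -, hord, hev⟩ := hpole
  obtain ⟨R, hR, Ψ, hΨ, hΨ0, hΦΨ, r, l, hrl⟩ := h.exists_continuation
  have hle : 𝓝[{w : ℂ | 0 < w.im}] z₀ ≤ 𝓝[≠] z₀ :=
    nhdsWithin_mono _ fun w (hw : 0 < w.im) (hwz : w = z₀) => by
      rw [hwz, hz₀] at hw
      exact lt_irrefl _ hw
  have hnebot : (𝓝[{w : ℂ | 0 < w.im}] z₀).NeBot := by
    rw [← mem_closure_iff_nhdsWithin_neBot, Complex.closure_setOfPred_lt_im]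
    exact hz₀.ge
  have hinf : Tendsto (fun z => ‖G z‖) (𝓝[{w : ℂ | 0 < w.im}] z₀) atTop :=
    tendsto_norm_atTop_iff_cobounded.2
      ((tendsto_cobounded_of_meromorphicOrderAt_neg hord).mono_left hle)
  have hw : Metric.ball (0 : ℂ) R ∈ 𝓝 (halfExp z₀) :=
    Metric.isOpen_ball.mem_nhds (by simpa using (norm_halfExp_le_one hz₀.ge).trans_lt hR)
  have hexp : ContinuousAt halfExp z₀ := differentiable_halfExp.continuous.continuousAt
  let F : ℂ → ℂ := fun z => -Ψ (halfExp z) / halfExp z ^ 2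
  have hF : ContinuousAt F z₀ :=
    ((ContinuousAt.comp (f := halfExp) (hΨ.continuousOn.continuousAt hw) hexp).neg).div
      (hexp.pow 2) (pow_ne_zero _ (halfExp_ne_zero z₀))
  have hF0 : F z₀ ≠ 0 := by rwa [hΦΨ z₀ hz₀.ge] at hne
  let H : ℂ → ℂ := fun z => if m ≤ n then r n z * l m z else l n z * r m z
  have hH : ContinuousAt H z₀ := by
    have hn := hrl z₀ hz₀.ge n
    have hm := hrl z₀ hz₀.ge m
    by_cases hnm : m ≤ n
    · simp only [H, if_pos hnm]
      exact hn.1.mul hm.2.1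
    · simp only [H, if_neg hnm]
      exact hn.2.1.mul hm.1
  have hlim : Tendsto (fun z => ‖H z / F z‖) (𝓝[{w : ℂ | 0 < w.im}] z₀) (𝓝 ‖H z₀ / F z₀‖) :=
    ((hH.div hF hF0).norm).tendsto.mono_left nhdsWithin_le_nhds
  have heq : ∀ᶠ z in 𝓝[{w : ℂ | 0 < w.im}] z₀, ‖H z / F z‖ = ‖G z‖ := by
    filter_upwards [hev, self_mem_nhdsWithin,
      (hF.eventually_ne hF0).filter_mono nhdsWithin_le_nhds] with z hz hzim hFz
    obtain ⟨Rz, hRz, hG⟩ := hz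
    have hzim' : 0 ≤ z.im := (show 0 < z.im from hzim).le
    have hker := h.resolvent_kernel_mul hzim' hRz n m
    rw [hG, hΦΨ z hzim', (hrl z hzim' n).2.2.1, (hrl z hzim' n).2.2.2, (hrl z hzim' m).2.2.1,
      (hrl z hzim' m).2.2.2] at hker
    rw [div_eq_iff hFz |>.2 hker.symm]
  exact not_tendsto_nhds_of_tendsto_atTop hinf _ (hlim.congr' heq)

/-! ### From `λ` to `z`, and the conclusion -/

theorem exists_two_mul_cos_eq (lam : ℂ) : ∃ z : ℂ,
    z.re ∈ Set.Icc (-Real.pi) (3 * Real.pi) ∧ 0 ≤ z.im ∧ lam = 2 * Complex.cos (z / 2) := by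
  obtain ⟨c, hc⟩ := Complex.cos_surjective (lam / 2)
  obtain ⟨b, hb, hcb⟩ : ∃ b : ℂ, 0 ≤ b.im ∧ lam = 2 * Complex.cos b := by
    rcases le_total 0 c.im with h | h
    · exact ⟨c, h, by rw [hc]; ring⟩
    · exact ⟨-c, by simpa using h, by rw [Complex.cos_neg, hc]; ring⟩
  have hπ := Real.two_pi_pos
  -- Evenness of the cosine has put `b` in the closed upper half plane. Its period `2π` now brings
  -- `b.re` into `[-π/2, 3π/2)`, and doubling gives the strip `[-π, 3π]`.
  obtain ⟨k, hk, -⟩ := existsUnique_sub_zsmul_mem_Ico hπ b.re (-(Real.pi / 2))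
  rw [zsmul_eq_mul] at hk
  refine ⟨2 * (b - k * (2 * Real.pi)), ?_, ?_, ?_⟩
  · have e : (2 * (b - k * (2 * Real.pi))).re = 2 * (b.re - k * (2 * Real.pi)) := by simp
    rw [e]
    constructor <;> linarith [hk.1, hk.2]
  · simpa using hb
  · rw [mul_div_cancel_left₀ _ two_ne_zero, Complex.cos_sub_int_mul_two_pi, hcb]

theorem im_nonneg_of_mem {z : ℂ} (hz : z ∈ halfStrip ∪ boundarySet) : 0 ≤ z.im := by
  rcases hz with hz | hz
  · exact hz.2.le
  · exact hz.1.ge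

theorem IsAdmissible.exists_zero_of_eigenvalue (h : IsAdmissible a p q) {lam : ℂ}
    (hlam : lam ∈ pencilEigenvalues a p q) :
    ∃ z ∈ halfStrip ∪ boundarySet, lam = 2 * Complex.cos (z / 2) ∧ jostPhi a p q z = 0 := by
  obtain ⟨y, hy0, hy⟩ := hlam
  obtain ⟨z, hre, him, rfl⟩ := exists_two_mul_cos_eq lam
  obtain ⟨hpos, hΦ⟩ := h.jostPhi_eq_zero_of_ellTwo him hy0 hy
  exact ⟨z, Or.inl ⟨hre, hpos⟩, rfl, hΦ⟩

theorem IsAdmissible.exists_zero_of_spectralSingularity (h : IsAdmissible a p q) {lam : ℂ}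
    (hlam : lam ∈ pencilSpectralSingularities a p q) :
    ∃ z ∈ halfStrip ∪ boundarySet, lam = 2 * Complex.cos (z / 2) ∧ jostPhi a p q z = 0 := by
  obtain ⟨z, hz, rfl, hpole⟩ := hlam
  exact ⟨z, Or.inr hz, rfl, h.jostPhi_eq_zero_of_pole hz.1 hpole⟩

theorem IsAdmissible.finite_image_zeros (h : IsAdmissible a p q) :
    {lam : ℂ | ∃ z ∈ halfStrip ∪ boundarySet,
      lam = 2 * Complex.cos (z / 2) ∧ jostPhi a p q z = 0}.Finite := by
  obtain ⟨R, hR, Ψ, hΨ, hΨ0, hΦΨ, -⟩ := h.exists_continuation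
  refine ((finite_zeros_of_differentiableOn_ball hR zero_le_one hΨ hΨ0).image
    fun w => w + w⁻¹).subset ?_
  rintro lam ⟨z, hz, rfl, hΦ⟩
  have him := im_nonneg_of_mem hz
  refine ⟨halfExp z, ⟨norm_halfExp_le_one him, ?_⟩, (two_mul_cos_eq z).symm⟩
  simpa [hΦΨ z him, halfExp_ne_zero] using hΦ

end Jost

theorem theorem8 (a p q : ℤ → ℂ) (ha : ∀ n : ℤ, a n ≠ 0)
    (hdecay : ∃ ε : ℝ, 0 < ε ∧
      BddAbove (Set.range fun n : ℤ =>
        Real.exp (ε * |(n : ℝ)|) * (‖1 - a n‖ + ‖p n‖ + ‖q n‖))) :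
    (pencilEigenvalues a p q).Finite ∧
      (pencilSpectralSingularities a p q).Finite ∧
      (∀ lam ∈ pencilEigenvalues a p q, HasFiniteMultiplicity a p q lam) ∧
      (∀ lam ∈ pencilSpectralSingularities a p q, HasFiniteMultiplicity a p q lam) := by
  obtain ⟨ε, hε, hbdd⟩ := hdecay
  obtain ⟨hright, hleft⟩ := decaysRight_of_bddAbove hε hbdd
  have h : IsAdmissible a p q := ⟨ha, hright, hleft⟩
  exact ⟨h.finite_image_zeros.subset fun _ => h.exists_zero_of_eigenvalue,
    h.finite_image_zeros.subset fun _ => h.exists_zero_of_spectralSingularity,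
    fun lam hlam => ⟨h.exists_zero_of_eigenvalue hlam,
      fun z hz _ hΦ => h.hasZeroOrder (im_nonneg_of_mem hz) hΦ⟩,
    fun lam hlam => ⟨h.exists_zero_of_spectralSingularity hlam,
      fun z hz _ hΦ => h.hasZeroOrder (im_nonneg_of_mem hz) hΦ⟩⟩
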